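/- Theorem 1.1. Let $n\ge 0$, let $[n]=\{1,\dots,n\}$, and let $D\subseteq[n]^2$ be a diagram, where $(i,j)$ denotes the box in row $i$ and column $j$ of the $n\times n$ grid, rows being numbered from top to bottom. For $S\subseteq[n]$ and $j\in[n]$, let $\mathrm{word}_{j,S}(D)$ be the word obtained by reading the $j$-th column from top to bottom and recording, in row $i$: "(" if $(i,j)\notin D$ and $i\in S$; ")" if $(i,j)\in D$ and $i\notin S$; "$\star$" if $(i,j)\in D$ and $i\in S$; and nothing otherwise. Let $\theta_D^j(S)$ be the number of pairs "()" in $\mathrm{word}_{j,S}(D)$ under the usual inside-out parenthesis matching (stars being ignored in the matching) plus the number of $\star$'s in $\mathrm{word}_{j,S}(D)$, and put $\theta_D(S)=\sum_{j=1}^n\theta_D^j(S)$. The Schubitope of $D$ is $$\mathcal{S}_D=\Big\{(x_1,\dots,x_n)\in\mathbb{R}^n:\ \sum_{i\in[n]}x_i=\#D\ \text{ and }\ \sum_{i\in S}x_i\le\theta_D(S)\ \text{ for all } S\subsetneq[n]\Big\}.$$ For a permutation $w=w_1w_2\cdots w_n\in S_n$, let $\mathcal{F}_w(D)$ be the filling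 of $D$ obtained by treating each column independently as follows: starting with all boxes of $D$ in the column empty, for $k=1,2,\dots,n$ in turn, put $w_k$ into the topmost empty box of $D$ in this column whose row index is at least $w_k$; if there is no such box, skip $w_k$ in this column. Let $x(w)=(x_1,\dots,x_n)$, where $x_k$ is the number of appearances of $k$ in $\mathcal{F}_w(D)$. Then the vertex set (set of extreme points) of $\mathcal{S}_D$ is $$\{x(w): w\in S_n\}.$$ -/

import Mathlib

namespace Schubitope

/-- The three symbols occurring in the words attached to the columns of a diagram. -/
inductive Letter where
  | lparen
  | rparen
  | star
  deriving DecidableEq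

/-- A diagram in the `n × n` grid: `(i, j)` is the box in row `i` and column `j`; rows are
numbered from top to bottom and columns from left to right (indices start at `0`). -/
abbrev Diagram (n : ℕ) : Type := Finset (Fin n × Fin n)

/-- The symbol recorded at row `i` when reading column `j`, if there is one. -/
def letter {n : ℕ} (D : Diagram n) (j : Fin n) (S : Finset (Fin n)) (i : Fin n) :
    Option Letter :=
  if (i, j) ∈ D then
    if i ∈ S then some Letter.star else some Letter.rparen
  else
    if i ∈ S then some Letter.lparen else none

/-- `word_{j,S}(D)`: the `j`-th column read from top to bottom. -/
def word {n : ℕ} (D : Diagram n) (j : Fin n) (S : Finset (Fin n)) : List Letter :=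
  (List.finRange n).filterMap (letter D j S)

/-- The number of pairs `()` formed by the inside-out pairing in a word that is preceded by `o`
still unpaired opening parentheses: a closing parenthesis is paired with the nearest unpaired
opening parenthesis on its left, if there is one; stars are ignored. -/
def pairsAux : ℕ → List Letter → ℕ
  | _, [] => 0
  | o, Letter.star :: l => pairsAux o l
  | o, Letter.lparen :: l => pairsAux (o + 1) l
  | 0, Letter.rparen :: l => pairsAux 0 l
  | o + 1, Letter.rparen :: l => pairsAux o l + 1

/-- The number of paired `()`'s in a word. -/
def pairs (l : List Letter) : ℕ := pairsAux 0 l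

/-- `θ_D^j(S)`: the number of paired `()`'s plus the number of stars of `word_{j,S}(D)`. -/
def thetaCol {n : ℕ} (D : Diagram n) (j : Fin n) (S : Finset (Fin n)) : ℕ :=
  pairs (word D j S) + (word D j S).count Letter.star

/-- `θ_D(S)`, the sum of the `θ_D^j(S)` over all columns. -/
def theta {n : ℕ} (D : Diagram n) (S : Finset (Fin n)) : ℕ :=
  ∑ j : Fin n, thetaCol D j S

/-- The Schubitope of `D`. -/
def schubitope {n : ℕ} (D : Diagram n) : Set (Fin n → ℝ) :=
  {x | ∑ i, x i = (D.card : ℝ) ∧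
    ∀ S : Finset (Fin n), S ⊂ Finset.univ → ∑ i ∈ S, x i ≤ (theta D S : ℝ)}

/-- The rows of the empty boxes of column `j` of `D` whose row index is at least `a`, when the
column is partially filled as described by `f` (`f i = none` if row `i` has no entry). -/
def available {n : ℕ} (D : Diagram n) (j : Fin n) (f : Fin n → Option (Fin n)) (a : Fin n) :
    Finset (Fin n) :=
  Finset.univ.filter fun i => (i, j) ∈ D ∧ f i = none ∧ a ≤ i

/-- Put `a` into the topmost empty box of column `j` whose row index is at least `a`; if there is
no such box, skip `a`. -/
def place {n : ℕ} (D : Diagram n) (j : Fin n) (f : Fin n → Option (Fin n)) (a : Fin n) :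
    Fin n → Option (Fin n) :=
  if h : (available D j f a).Nonempty then
    Function.update f ((available D j f a).min' h) (some a)
  else f

/-- `F_w(D)`: the entry at row `i`, column `j`, where each column is filled independently by
placing `w_1, …, w_n` in turn, starting from the empty column. -/
def filling {n : ℕ} (D : Diagram n) (w : Equiv.Perm (Fin n)) (i j : Fin n) : Option (Fin n) :=
  (List.ofFn w).foldl (place D j) (fun _ => none) i

/-- The number of appearances of `k` in the filling `F_w(D)`. -/
def appearances {n : ℕ} (D : Diagram n) (w : Equiv.Perm (Fin n)) (k : Fin n) : ℕ :=
  (D.filter fun b => filling D w b.1 b.2 = some k).card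

/-- The vector `x(w)`. -/
def xVec {n : ℕ} (D : Diagram n) (w : Equiv.Perm (Fin n)) : Fin n → ℝ :=
  fun k => (appearances D w k : ℝ)

end Schubitope

/-!
The Schubitope is the base polytope of `θ_D`, and `θ_D` is submodular, so its vertices are the
greedy vectors: the points for which the constraints of all sets in some complete chain
`∅ ⊂ {w₁} ⊂ {w₁, w₂} ⊂ ⋯` are tight (`Submodular.mem_extremePoints_basePolytope_iff`). It remains
to see that `x(w)` is the point belonging to the chain of `w`.

Both submodularity and this identification come from a min-max formula in each column. Say that a
letter `a` may be matched with a box of the column in any row `i ≥ a`. Then `θ_D^j(S)` is the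
minimum, over lower sets `U` of rows, of `#(S ∩ U)` plus the number of boxes outside `U`
(`thetaCol_le_cover`, `exists_cover_eq_thetaCol`); this is proved by reading the word letter by
letter. Lower sets form a chain, which makes the minimum submodular (`thetaCol_submodular`). The
filling rule matches letters with boxes greedily, and the rows weakly above some empty box
form a lower set that certifies the optimality of the matching (`IsGreedyFilling.card_filled`).
Hence after placing `w₁, …, w_k` exactly `θ_D^j({w₁, …, w_k})` boxes of column `j` are filled;
summing over `j` shows that `x(w)` is tight on `{w₁, …, w_k}` (`sum_appearances_eq_theta`).

An extreme point has a complete chain of tight sets because tight sets are closed under union and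
intersection, and any two coordinates are separated by one (`exists_tight_separating`).
-/

/-! ### The function `θ` of a column as a minimum over vertex covers -/

namespace Schubitope

theorem pairsAux_add_count_le_countP {n : ℕ} (D : Diagram n) (j : Fin n) (S : Finset (Fin n))
    (L : List (Fin n)) (o : ℕ) :
    pairsAux o (L.filterMap (letter D j S)) + (L.filterMap (letter D j S)).count Letter.star ≤
      L.countP (fun i => (i, j) ∈ D) := by
  induction L generalizing o with
  | nil => simp [pairsAux]
  | cons a L ih =>
    by_cases hD : (a, j) ∈ D <;> by_cases hS : a ∈ S
    · have := ih o
      simp [letter, hD, hS, pairsAux] at this ⊢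
      omega
    · rcases o with _ | o
      · have := ih 0
        simp [letter, hD, hS, pairsAux] at this ⊢
        omega
      · have := ih o
        simp [letter, hD, hS, pairsAux] at this ⊢
        omega
    · have := ih (o + 1)
      simp [letter, hD, hS, pairsAux] at this ⊢
      omega
    · have := ih o
      simp [letter, hD, hS] at this ⊢
      omega

/-- An opening parenthesis can be charged before the split, a closing one after it: each pair is
charged at least once, and each star exactly once. -/
theorem pairsAux_add_count_le_split {n : ℕ} (D : Diagram n) (j : Fin n) (S : Finset (Fin n))
    (L₁ L₂ : List (Fin n)) (o : ℕ) :
    pairsAux o ((L₁ ++ L₂).filterMap (letter D j S)) +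
        ((L₁ ++ L₂).filterMap (letter D j S)).count Letter.star ≤
      o + L₁.countP (fun i => i ∈ S) + L₂.countP (fun i => (i, j) ∈ D) := by
  induction L₁ generalizing o with
  | nil =>
    have := pairsAux_add_count_le_countP D j S L₂ o
    simp only [List.nil_append, List.countP_nil]
    omega
  | cons a L ih =>
    by_cases hD : (a, j) ∈ D <;> by_cases hS : a ∈ S
    · have := ih o
      simp [letter, hD, hS, pairsAux] at this ⊢
      omega
    · rcases o with _ | o
      · have := ih 0
        simp [letter, hD, hS, pairsAux] at this ⊢
        omega
      · have := ih o
        simp [letter, hD, hS, pairsAux] at this ⊢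
        omega
    · have := ih (o + 1)
      simp [letter, hD, hS, pairsAux] at this ⊢
      omega
    · have := ih o
      simp [letter, hD, hS] at this ⊢
      omega

/-- With `o` unpaired opening parentheses in front, the bounds of `pairsAux_add_count_le_countP` and
`pairsAux_add_count_le_split` are attained: either every box is used by a pair or a star, or the
word splits so that every opening parenthesis before the split is paired. -/
theorem exists_split_pairsAux_add_count_eq {n : ℕ} (D : Diagram n) (j : Fin n)
    (S : Finset (Fin n)) (L : List (Fin n)) (o : ℕ) :
    pairsAux o (L.filterMap (letter D j S)) + (L.filterMap (letter D j S)).count Letter.star =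
        L.countP (fun i => (i, j) ∈ D) ∨
      ∃ L₁ L₂, L = L₁ ++ L₂ ∧
        pairsAux o (L.filterMap (letter D j S)) + (L.filterMap (letter D j S)).count Letter.star =
          o + L₁.countP (fun i => i ∈ S) + L₂.countP (fun i => (i, j) ∈ D) := by
  induction L generalizing o with
  | nil => simp [pairsAux]
  | cons a L ih =>
    by_cases hD : (a, j) ∈ D <;> by_cases hS : a ∈ S
    · rcases ih o with h | ⟨L₁, L₂, rfl, h⟩
      · left
        simp [letter, hD, hS, pairsAux] at h ⊢
        omega
      · refine Or.inr ⟨a :: L₁, L₂, rfl, ?_⟩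
        simp [letter, hD, hS, pairsAux] at h ⊢
        omega
    · rcases o with _ | o
      · -- An unpaired closing parenthesis: the split may be taken right after it or later.
        rcases ih 0 with h | ⟨L₁, L₂, rfl, h⟩
        · refine Or.inr ⟨[a], L, rfl, ?_⟩
          simp [letter, hD, hS, pairsAux] at h ⊢
          omega
        · refine Or.inr ⟨a :: L₁, L₂, rfl, ?_⟩
          simp [letter, hD, hS, pairsAux] at h ⊢
          omega
      · rcases ih o with h | ⟨L₁, L₂, rfl, h⟩
        · left
          simp [letter, hD, hS, pairsAux] at h ⊢
          omega
        · refine Or.inr ⟨a :: L₁, L₂, rfl, ?_⟩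
          simp [letter, hD, hS, pairsAux] at h ⊢
          omega
    · rcases ih (o + 1) with h | ⟨L₁, L₂, rfl, h⟩
      · left
        simp [letter, hD, hS, pairsAux] at h ⊢
        omega
      · refine Or.inr ⟨a :: L₁, L₂, rfl, ?_⟩
        simp [letter, hD, hS, pairsAux] at h ⊢
        omega
    · rcases ih o with h | ⟨L₁, L₂, rfl, h⟩
      · left
        simp [letter, hD, hS] at h ⊢
        omega
      · refine Or.inr ⟨a :: L₁, L₂, rfl, ?_⟩
        simp [letter, hD, hS] at h ⊢
        omega

/-- The rows of the boxes of `D` in column `j`. -/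
def column {n : ℕ} (D : Diagram n) (j : Fin n) : Finset (Fin n) :=
  Finset.univ.filter fun i => (i, j) ∈ D

@[simp]
theorem mem_column {n : ℕ} {D : Diagram n} {i j : Fin n} : i ∈ column D j ↔ (i, j) ∈ D := by
  simp [column]

/-- The size of the vertex cover of the column given by a set `U` of rows: the elements of `S` in
`U` together with the boxes outside `U`. When `U` is a lower set, every pair `(a, i)` of an element
`a ∈ S` and a box in a row `i ≥ a` is covered. -/
def cover {n : ℕ} (D : Diagram n) (j : Fin n) (U S : Finset (Fin n)) : ℕ :=
  (S ∩ U).card + (column D j \ U).card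

theorem countP_eq_card_filter {α : Type*} [DecidableEq α] {L : List α} (hL : L.Nodup)
    (p : α → Prop) [DecidablePred p] :
    L.countP (fun i => p i) = (L.toFinset.filter p).card := by
  rw [List.countP_eq_length_filter, ← List.toFinset_card_of_nodup (hL.filter _)]
  congr 1
  ext; simp

theorem split_eq_cover {n : ℕ} (D : Diagram n) (j : Fin n) (S : Finset (Fin n))
    {L₁ L₂ : List (Fin n)} (h : List.finRange n = L₁ ++ L₂) :
    L₁.countP (fun i => i ∈ S) + L₂.countP (fun i => (i, j) ∈ D) = cover D j L₁.toFinset S := by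
  have hnd : (L₁ ++ L₂).Nodup := h ▸ List.nodup_finRange n
  have hmem : ∀ i, i ∈ L₁ ∨ i ∈ L₂ := fun i => by
    rw [← List.mem_append, ← h]; exact List.mem_finRange i
  have hdis := List.nodup_append.1 hnd
  rw [countP_eq_card_filter hdis.1, countP_eq_card_filter hdis.2.1, cover]
  congr 2
  · ext i; simp [and_comm]
  · ext i
    have h1 := hmem i
    have h2 : i ∈ L₁ → i ∈ L₂ → False := fun a b => hdis.2.2 i a i b rfl
    simp; tauto

theorem thetaCol_le_cover {n : ℕ} (D : Diagram n) (j : Fin n) (S : Finset (Fin n))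
    {U : Finset (Fin n)} (hU : IsLowerSet (U : Set (Fin n))) :
    thetaCol D j S ≤ cover D j U S := by
  have hsplit : List.finRange n =
      (List.finRange n).filter (· ∈ U) ++ (List.finRange n).filter (· ∉ U) := by
    have hs : (List.finRange n).Pairwise (· < ·) := List.pairwise_lt_finRange n
    refine List.Perm.eq_of_pairwise (le := (· < ·)) ?_ hs ?_ ?_
    · intro a b _ _ h1 h2; exact absurd h1 h2.asymm
    · refine List.pairwise_append.2 ⟨hs.filter _, hs.filter _, ?_⟩
      intro a ha b hb
      simp at ha hb
      by_contra hlt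
      exact hb (hU (not_lt.1 hlt) ha)
    · have := (List.filter_append_perm (fun i => decide (i ∈ U)) (List.finRange n)).symm
      simpa using this
  have h := pairsAux_add_count_le_split D j S _ _ 0 |>.trans_eq
    (by rw [zero_add, split_eq_cover D j S hsplit])
  rw [← hsplit] at h
  simpa [thetaCol, pairs, word] using h

theorem exists_cover_eq_thetaCol {n : ℕ} (D : Diagram n) (j : Fin n) (S : Finset (Fin n)) :
    ∃ U : Finset (Fin n), IsLowerSet (U : Set (Fin n)) ∧ thetaCol D j S = cover D j U S := by
  rcases exists_split_pairsAux_add_count_eq D j S (List.finRange n) 0 with h | ⟨L₁, L₂, hL, h⟩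
  · refine ⟨∅, by simp [isLowerSet_empty], ?_⟩
    have := split_eq_cover D j S (L₁ := []) (L₂ := List.finRange n) rfl
    simp only [List.countP_nil, zero_add, List.toFinset_nil] at this
    rw [← this, ← h]; rfl
  · refine ⟨L₁.toFinset, ?_, ?_⟩
    · intro a b hba ha
      have hs : (L₁ ++ L₂).Pairwise (· < ·) := hL ▸ List.pairwise_lt_finRange n
      have hb : b ∈ L₁ ++ L₂ := hL ▸ List.mem_finRange b
      simp at ha ⊢
      rcases List.mem_append.1 hb with hb | hb
      · exact hb
      · exact absurd ((List.pairwise_append.1 hs).2.2 a ha b hb) (not_lt.2 hba)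
    · rw [← split_eq_cover D j S hL]
      simpa [thetaCol, pairs, word] using h

/-- Submodularity of covers along a chain; the intersection goes with the larger lower set `V`,
because between `U` and `V` only elements of `T` are counted, and `S ∩ T ⊆ T`. -/
theorem cover_inter_add_cover_union_le {n : ℕ} (D : Diagram n) (j : Fin n)
    {U V : Finset (Fin n)} (h : U ⊆ V) (S T : Finset (Fin n)) :
    cover D j V (S ∩ T) + cover D j U (S ∪ T) ≤ cover D j U S + cover D j V T := by
  have h1 : ((S ∩ T) ∩ V).card + ((S ∪ T) ∩ U).card ≤ (S ∩ U).card + (T ∩ V).card := by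
    rw [← Finset.card_union_add_card_inter (S ∩ U), ← Finset.card_union_add_card_inter (S ∩ T ∩ V)]
    refine add_le_add (Finset.card_le_card fun i => ?_) (Finset.card_le_card fun i => ?_) <;>
      have := @h i <;> simp only [Finset.mem_union, Finset.mem_inter] <;> tauto
  unfold cover
  omega

theorem thetaCol_submodular {n : ℕ} (D : Diagram n) (j : Fin n) (S T : Finset (Fin n)) :
    thetaCol D j (S ∩ T) + thetaCol D j (S ∪ T) ≤ thetaCol D j S + thetaCol D j T := by
  obtain ⟨U, hU, hS⟩ := exists_cover_eq_thetaCol D j S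
  obtain ⟨V, hV, hT⟩ := exists_cover_eq_thetaCol D j T
  rw [hS, hT]
  rcases hU.total hV with h | h
  · exact (add_le_add (thetaCol_le_cover D j _ hV) (thetaCol_le_cover D j _ hU)).trans
      (cover_inter_add_cover_union_le D j (Finset.coe_subset.1 h) S T)
  · have := cover_inter_add_cover_union_le D j (Finset.coe_subset.1 h) T S
    rw [Finset.inter_comm T, Finset.union_comm T] at this
    have h1 := thetaCol_le_cover D j (S ∩ T) hU
    have h2 := thetaCol_le_cover D j (S ∪ T) hV
    omega

theorem thetaCol_empty {n : ℕ} (D : Diagram n) (j : Fin n) : thetaCol D j ∅ = 0 := by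
  have := thetaCol_le_cover D j ∅ (U := Finset.univ) (by simp [isLowerSet_univ])
  simpa [cover, Finset.sdiff_eq_empty_iff_subset.2 (Finset.subset_univ _)] using this

theorem thetaCol_univ {n : ℕ} (D : Diagram n) (j : Fin n) :
    thetaCol D j Finset.univ = (column D j).card := by
  apply le_antisymm
  · have := thetaCol_le_cover D j Finset.univ (U := ∅) (by simp [isLowerSet_empty])
    simpa [cover] using this
  · obtain ⟨U, -, hU⟩ := exists_cover_eq_thetaCol D j Finset.univ
    rw [hU, cover, Finset.univ_inter, ← Finset.card_inter_add_card_sdiff (column D j) U]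
    gcongr
    exact Finset.inter_subset_right

end Schubitope

/-! ### Vertices of the base polytope of a submodular function -/

namespace Submodular
open Finset
variable {ι : Type*} [DecidableEq ι]

/-- The base polytope of a set function `f`: the vectors `x` with `x(S) ≤ f(S)` for every `S`, with
equality for the whole ground set. -/
def basePolytope [Fintype ι] (f : Finset ι → ℝ) : Set (ι → ℝ) :=
  {x | ∑ i, x i = f univ ∧ ∀ S, ∑ i ∈ S, x i ≤ f S}

/-- `x` is tight on every initial segment of the list `l`. -/
def PrefixTight (f : Finset ι → ℝ) (x : ι → ℝ) (l : List ι) : Prop :=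
  ∀ p, p <+: l → ∑ i ∈ p.toFinset, x i = f p.toFinset

theorem PrefixTight.eq_of_mem {f : Finset ι → ℝ} {x y : ι → ℝ} {l : List ι} (hl : l.Nodup)
    (hx : PrefixTight f x l) (hy : PrefixTight f y l) {a : ι} (ha : a ∈ l) : x a = y a := by
  obtain ⟨p, q, rfl⟩ := List.append_of_mem ha
  have hap : a ∉ p.toFinset := by
    have := List.nodup_append.1 hl
    rw [List.mem_toFinset]
    exact fun h => this.2.2 a h a (by simp) rfl
  have h1 : p <+: p ++ a :: q := List.prefix_append _ _
  have h2 : p ++ [a] <+: p ++ a :: q := ⟨q, by simp⟩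
  have e : (p ++ [a]).toFinset = insert a p.toFinset := by ext; simp
  have hx1 := hx _ h1
  have hx2 := hx _ h2
  have hy1 := hy _ h1
  have hy2 := hy _ h2
  rw [e, sum_insert hap] at hx2 hy2
  linarith

/-- Compared along the chain of initial segments: by submodularity, adding the next letter to
`S ∩ p` increases `f` at least as much as adding it to `p`, and the latter increase is its
coordinate in `x`. -/
theorem PrefixTight.sum_le {f : Finset ι → ℝ} (hf : ∀ S T, f (S ∩ T) + f (S ∪ T) ≤ f S + f T)
    (h0 : f ∅ = 0) {x : ι → ℝ} {l : List ι} (hl : l.Nodup) (hx : PrefixTight f x l)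
    (S : Finset ι) : ∑ i ∈ S ∩ l.toFinset, x i ≤ f (S ∩ l.toFinset) := by
  induction l using List.reverseRecOn with
  | nil => simp [h0]
  | append_singleton p a ih =>
    have hp : PrefixTight f x p := fun q hq => hx q (hq.trans (List.prefix_append _ _))
    have hnd := List.nodup_append.1 hl
    have hap : a ∉ p.toFinset := by
      rw [List.mem_toFinset]
      exact fun h => hnd.2.2 a h a (by simp) rfl
    have ih := ih hnd.1 hp
    have e : (p ++ [a]).toFinset = insert a p.toFinset := by ext; simp
    have hx1 := hp p List.prefix_rfl
    have hx2 := hx _ List.prefix_rfl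
    rw [e] at hx2 ⊢
    rw [sum_insert hap] at hx2
    by_cases haS : a ∈ S
    · have haSp : a ∉ S ∩ p.toFinset := fun h => hap (mem_inter.1 h).2
      have h := hf (insert a (S ∩ p.toFinset)) p.toFinset
      have e1 : insert a (S ∩ p.toFinset) ∩ p.toFinset = S ∩ p.toFinset := by
        rw [insert_inter_of_notMem hap, inter_assoc, inter_self]
      have e2 : insert a (S ∩ p.toFinset) ∪ p.toFinset = insert a p.toFinset := by
        rw [insert_union, union_eq_right.2 inter_subset_right]
      rw [e1, e2] at h
      rw [inter_insert_of_mem haS, sum_insert haSp]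
      linarith
    · rwa [inter_insert_of_notMem haS]

theorem PrefixTight.mem_basePolytope [Fintype ι] {f : Finset ι → ℝ}
    (hf : ∀ S T, f (S ∩ T) + f (S ∪ T) ≤ f S + f T) (h0 : f ∅ = 0) {x : ι → ℝ} {l : List ι}
    (hl : l.Nodup) (hmem : ∀ i, i ∈ l) (hx : PrefixTight f x l) : x ∈ basePolytope f := by
  have e : l.toFinset = univ := by ext; simp [hmem]
  refine ⟨by simpa [e] using hx l List.prefix_rfl, fun S => ?_⟩
  simpa [e] using hx.sum_le hf h0 hl S

theorem PrefixTight.mem_extremePoints [Fintype ι] {f : Finset ι → ℝ}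
    (hf : ∀ S T, f (S ∩ T) + f (S ∪ T) ≤ f S + f T) (h0 : f ∅ = 0) {x : ι → ℝ} {l : List ι}
    (hl : l.Nodup) (hmem : ∀ i, i ∈ l) (hx : PrefixTight f x l) :
    x ∈ (basePolytope f).extremePoints ℝ := by
  refine ⟨hx.mem_basePolytope hf h0 hl hmem, fun y hy z hz hyz => ?_⟩
  obtain ⟨s, t, hs, ht, hst, rfl⟩ := hyz
  have hyt : PrefixTight f y l := by
    intro p hp
    -- A convex combination of two numbers `≤ f p` with positive weights equals `f p`.
    have h := hx p hp
    simp only [Pi.add_apply, Pi.smul_apply, smul_eq_mul, sum_add_distrib, ← mul_sum] at h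
    refine le_antisymm (hy.2 _) ?_
    have hz' := mul_le_mul_of_nonneg_left (hz.2 p.toFinset) ht.le
    have : t = 1 - s := by linarith
    subst this
    exact le_of_mul_le_mul_left (by linarith) hs
  funext a
  exact hyt.eq_of_mem hl hx (hmem a)

/-- At an extreme point any two coordinates are separated by a tight set: otherwise all
constraints involving exactly one of the two coordinates have slack, and a small amount could be moved
from either coordinate to the other. -/
theorem exists_tight_separating [Fintype ι] {f : Finset ι → ℝ} {x : ι → ℝ}
    (hx : x ∈ (basePolytope f).extremePoints ℝ) {a b : ι} (hab : a ≠ b) :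
    ∃ T : Finset ι, ∑ i ∈ T, x i = f T ∧ ¬(a ∈ T ↔ b ∈ T) := by
  by_contra! hcon
  obtain ⟨ε, hε, hslack⟩ : ∃ ε > 0, ∀ T : Finset ι, ¬(a ∈ T ↔ b ∈ T) →
      ∑ i ∈ T, x i + ε ≤ f T := by
    have : ∀ᶠ ε : ℝ in nhdsWithin 0 (Set.Ioi 0), ∀ T : Finset ι, ¬(a ∈ T ↔ b ∈ T) →
        ∑ i ∈ T, x i + ε ≤ f T := by
      refine Filter.eventually_all.2 fun T => ?_
      by_cases hT : a ∈ T ↔ b ∈ T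
      · simp [hT]
      · have hlt : 0 < f T - ∑ i ∈ T, x i :=
          sub_pos.2 (lt_of_le_of_ne (hx.1.2 T) fun h => hT (hcon T h))
        filter_upwards [nhdsWithin_le_nhds (Iio_mem_nhds hlt)] with ε hε _
        rw [Set.mem_Iio] at hε
        linarith
    obtain ⟨ε, h1, h2⟩ := (this.and self_mem_nhdsWithin).exists
    exact ⟨ε, h2, h1⟩
  set v : ι → ℝ := Pi.single a ε - Pi.single b ε with hv
  have hsum : ∀ T : Finset ι, ∑ i ∈ T, v i = (if a ∈ T then ε else 0) - if b ∈ T then ε else 0 := by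
    intro T
    simp [hv]
  have hmove : ∀ c : ℝ, |c| = 1 → x + c • v ∈ basePolytope f := by
    intro c hc
    have hc' := abs_le.1 hc.le
    refine ⟨?_, fun T => ?_⟩
    · simp only [Pi.add_apply, Pi.smul_apply, smul_eq_mul, sum_add_distrib, ← mul_sum, hsum]
      simpa using hx.1.1
    · simp only [Pi.add_apply, Pi.smul_apply, smul_eq_mul, sum_add_distrib, ← mul_sum, hsum]
      have h1 := hx.1.2 T
      have h2 := hslack T
      by_cases ha : a ∈ T <;> by_cases hb : b ∈ T <;> simp [ha, hb] at h2 ⊢ <;>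
        nlinarith
  have hseg : x ∈ openSegment ℝ (x + (1 : ℝ) • v) (x + (-1 : ℝ) • v) :=
    ⟨1 / 2, 1 / 2, by norm_num, by norm_num, by norm_num, by ext i; simp; ring⟩
  have hfix := congrFun (hx.2 (hmove 1 (by simp)) (hmove (-1) (by simp)) hseg) a
  simp [hv, hab] at hfix
  exact hε.ne' hfix

/-- Tight sets are closed under intersection and union. -/
theorem tight_inter_union [Fintype ι] {f : Finset ι → ℝ}
    (hf : ∀ S T, f (S ∩ T) + f (S ∪ T) ≤ f S + f T)
    {x : ι → ℝ} (hx : x ∈ basePolytope f) {S T : Finset ι} (hS : ∑ i ∈ S, x i = f S)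
    (hT : ∑ i ∈ T, x i = f T) :
    ∑ i ∈ S ∩ T, x i = f (S ∩ T) ∧ ∑ i ∈ S ∪ T, x i = f (S ∪ T) := by
  have h1 := hx.2 (S ∩ T)
  have h2 := hx.2 (S ∪ T)
  have h3 := hf S T
  have h4 := Finset.sum_union_inter (s₁ := S) (s₂ := T) (f := x)
  constructor <;> linarith

/-- A tight set properly contained in the ground set can be enlarged by a single element: a minimal
tight set above it cannot have two further elements, as a tight set separating those would
cut it. -/
theorem exists_insert_tight [Fintype ι] {f : Finset ι → ℝ}
    (hf : ∀ S T, f (S ∩ T) + f (S ∪ T) ≤ f S + f T)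
    {x : ι → ℝ} (hx : x ∈ (basePolytope f).extremePoints ℝ) {A : Finset ι}
    (hA : ∑ i ∈ A, x i = f A) (hne : A ≠ univ) :
    ∃ a ∉ A, ∑ i ∈ insert a A, x i = f (insert a A) := by
  obtain ⟨B, hB⟩ := Finset.exists_minimal
    (s := univ.filter fun B : Finset ι => A ⊂ B ∧ ∑ i ∈ B, x i = f B)
    ⟨univ, by simpa [Finset.ssubset_univ_iff, hne] using hx.1.1⟩
  have hB' := hB.prop
  simp only [mem_filter, mem_univ, true_and] at hB'
  obtain ⟨hAB, hBt⟩ := hB'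
  obtain ⟨a, haB, haA⟩ := exists_of_ssubset hAB
  have hcov : insert a A = B := by
    refine subset_antisymm (insert_subset haB hAB.subset) fun b hb => ?_
    by_contra hbA
    rw [mem_insert, not_or] at hbA
    obtain ⟨T, hT, hsep⟩ := exists_tight_separating hx hbA.1
    have hC := (tight_inter_union hf hx.1 hA (tight_inter_union hf hx.1 hBt hT).1).2
    have hCB : A ∪ B ∩ T ⊆ B := union_subset hAB.subset inter_subset_left
    have hAC : A ⊂ A ∪ B ∩ T := by
      refine subset_union_left.ssubset_of_ne fun h => ?_
      have h1 : a ∈ B ∩ T → a ∈ A := fun h' => h ▸ mem_union_right _ h'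
      have h2 : b ∈ B ∩ T → b ∈ A := fun h' => h ▸ mem_union_right _ h'
      simp only [mem_inter] at h1 h2
      tauto
    have hBC := hB.le_of_le (by simpa using ⟨hAC, hC⟩) hCB
    have h1 := hBC haB
    have h2 := hBC hb
    simp only [mem_union, mem_inter] at h1 h2
    tauto
  exact ⟨a, haA, hcov ▸ hBt⟩

theorem exists_prefixTight [Fintype ι] {f : Finset ι → ℝ}
    (hf : ∀ S T, f (S ∩ T) + f (S ∪ T) ≤ f S + f T)
    (h0 : f ∅ = 0) {x : ι → ℝ} (hx : x ∈ (basePolytope f).extremePoints ℝ) :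
    ∃ l : List ι, l.Nodup ∧ (∀ i, i ∈ l) ∧ PrefixTight f x l := by
  have key : ∀ k ≤ Fintype.card ι, ∃ l : List ι, l.Nodup ∧ l.length = k ∧ PrefixTight f x l := by
    intro k
    induction k with
    | zero =>
      exact fun _ => ⟨[], by simp, rfl, fun p hp => by simp [List.prefix_nil.1 hp, h0]⟩
    | succ k ih =>
      intro hk
      obtain ⟨l, hl, hlen, ht⟩ := ih (by omega)
      have hne : l.toFinset ≠ univ := fun h => by
        have := List.toFinset_card_of_nodup hl
        rw [h, card_univ] at this
        omega
      obtain ⟨a, ha, hat⟩ := exists_insert_tight hf hx (ht l List.prefix_rfl) hne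
      rw [List.mem_toFinset] at ha
      refine ⟨l ++ [a], ?_, by simp [hlen], fun p hp => ?_⟩
      · exact List.nodup_append.2 ⟨hl, by simp, by
          intro b hb c hc; simp at hc; subst hc; rintro rfl; exact ha hb⟩
      · rcases List.prefix_concat_iff.1 hp with rfl | h
        · have e : (l ++ [a]).toFinset = insert a l.toFinset := by ext; simp
          simpa only [e] using hat
        · exact ht p h
  obtain ⟨l, hl, hlen, ht⟩ := key _ le_rfl
  refine ⟨l, hl, fun i => ?_, ht⟩
  have : l.toFinset = univ := by
    rw [← card_eq_iff_eq_univ, List.toFinset_card_of_nodup hl, hlen]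
  rw [← List.mem_toFinset, this]
  exact mem_univ i

/-- **Edmonds' greedy description** of the vertices of the base polytope of a submodular function. -/
theorem mem_extremePoints_basePolytope_iff [Fintype ι] {f : Finset ι → ℝ}
    (hf : ∀ S T, f (S ∩ T) + f (S ∪ T) ≤ f S + f T) (h0 : f ∅ = 0) {x : ι → ℝ} :
    x ∈ (basePolytope f).extremePoints ℝ ↔
      ∃ l : List ι, l.Nodup ∧ (∀ i, i ∈ l) ∧ PrefixTight f x l :=
  ⟨exists_prefixTight hf h0, fun ⟨_, hl, hmem, ht⟩ => ht.mem_extremePoints hf h0 hl hmem⟩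

end Submodular

/-! ### The greedy filling of a column -/

namespace Schubitope

/-- The partial filling of column `j` after the letters of `l` have been placed in turn. -/
def colFill {n : ℕ} (D : Diagram n) (j : Fin n) (l : List (Fin n)) : Fin n → Option (Fin n) :=
  l.foldl (place D j) fun _ => none

theorem place_cases {n : ℕ} (D : Diagram n) (j : Fin n) (f : Fin n → Option (Fin n)) (a : Fin n) :
    (place D j f a = f ∧ ∀ i, (i, j) ∈ D → a ≤ i → f i ≠ none) ∨
      ∃ r, (r, j) ∈ D ∧ f r = none ∧ a ≤ r ∧ place D j f a = Function.update f r (some a) ∧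
        ∀ i, (i, j) ∈ D → a ≤ i → i < r → f i ≠ none := by
  by_cases h : (available D j f a).Nonempty
  · right
    have hmem := Finset.min'_mem _ h
    simp only [available, Finset.mem_filter, Finset.mem_univ, true_and] at hmem
    refine ⟨_, hmem.1, hmem.2.1, hmem.2.2, by simp only [place, h, dite_true]; rfl, ?_⟩
    intro i hi hai hlt hnone
    exact absurd (Finset.min'_le (available D j f a) i (by simp [available, hi, hai, hnone]))
      (not_le.2 hlt)
  · left
    refine ⟨by simp [place, h], fun i hi hai hnone => h ⟨i, by simp [available, hi, hai, hnone]⟩⟩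

theorem foldl_place_eq_some {n : ℕ} {D : Diagram n} {j : Fin n} (l : List (Fin n))
    {f : Fin n → Option (Fin n)} {i a : Fin n} (h : f i = some a) :
    l.foldl (place D j) f i = some a := by
  induction l generalizing f with
  | nil => exact h
  | cons b l ih =>
    refine ih ?_
    rcases place_cases D j f b with ⟨e, -⟩ | ⟨r, -, hr, -, e, -⟩
    · rw [e, h]
    · have : i ≠ r := by rintro rfl; simp [h] at hr
      rw [e, Function.update_of_ne this, h]

theorem eq_some_or_mem_of_foldl_place {n : ℕ} {D : Diagram n} {j : Fin n} (l : List (Fin n))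
    {f : Fin n → Option (Fin n)} {i a : Fin n} (h : l.foldl (place D j) f i = some a) :
    f i = some a ∨ a ∈ l := by
  induction l generalizing f with
  | nil => exact Or.inl h
  | cons b l ih =>
    rcases ih h with h | h
    · rcases place_cases D j f b with ⟨e, -⟩ | ⟨r, -, hr, -, e, -⟩
      · exact Or.inl (e ▸ h)
      · rw [e, Function.update_apply] at h
        split_ifs at h
        · simp at h; simp [h]
        · exact Or.inl h
    · simp [h]

/-- What the greedy procedure guarantees for a partial filling `f` of column `j` by the letters of
`l`: distinct letters of `l` stand in boxes weakly below their own row, a letter that was skipped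
has no empty box weakly below its row, and the boxes between the row of a letter and its position
are filled. -/
structure IsGreedyFilling {n : ℕ} (D : Diagram n) (j : Fin n) (l : List (Fin n))
    (f : Fin n → Option (Fin n)) : Prop where
  mem_box : ∀ {i a}, f i = some a → (i, j) ∈ D
  mem_list : ∀ {i a}, f i = some a → a ∈ l
  le_row : ∀ {i a}, f i = some a → a ≤ i
  injective : ∀ {i i' a}, f i = some a → f i' = some a → i = i'
  full_of_skipped : ∀ {a}, a ∈ l → (∀ i, f i ≠ some a) → ∀ i, (i, j) ∈ D → a ≤ i → f i ≠ none
  full_above : ∀ {i a}, f i = some a → ∀ i', (i', j) ∈ D → a ≤ i' → i' < i → f i' ≠ none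

theorem isGreedyFilling_colFill {n : ℕ} (D : Diagram n) (j : Fin n) {l : List (Fin n)}
    (hl : l.Nodup) : IsGreedyFilling D j l (colFill D j l) := by
  induction l using List.reverseRecOn with
  | nil => constructor <;> simp [colFill]
  | append_singleton l b ih =>
    have hnd := List.nodup_append.1 hl
    have hb : b ∉ l := fun h => hnd.2.2 b h b (by simp) rfl
    have ih := ih hnd.1
    have e0 : colFill D j (l ++ [b]) = place D j (colFill D j l) b := by
      simp [colFill, List.foldl_append]
    rw [e0]
    rcases place_cases D j (colFill D j l) b with ⟨e, hfull⟩ | ⟨r, hrD, hr, hbr, e, htop⟩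
    · rw [e]
      refine ⟨ih.mem_box, fun h => List.mem_append_left _ (ih.mem_list h), ih.le_row,
        ih.injective, fun {a} ha hskip => ?_, ih.full_above⟩
      rcases List.mem_append.1 ha with ha | ha
      · exact ih.full_of_skipped ha hskip
      · rw [List.mem_singleton] at ha; subst ha; exact hfull
    · rw [e]
      set f := colFill D j l with hf
      have hupd : ∀ {i a}, Function.update f r (some b) i = some a →
          (i = r ∧ a = b) ∨ (i ≠ r ∧ f i = some a) := by
        intro i a h
        by_cases hi : i = r
        · subst hi; simp at h; exact Or.inl ⟨rfl, h.symm⟩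
        · rw [Function.update_of_ne hi] at h; exact Or.inr ⟨hi, h⟩
      have hmono : ∀ {i}, f i ≠ none → Function.update f r (some b) i ≠ none := by
        intro i h
        by_cases hi : i = r
        · subst hi; simp
        · rwa [Function.update_of_ne hi]
      constructor
      · intro i a h
        rcases hupd h with ⟨rfl, rfl⟩ | ⟨-, h⟩
        exacts [hrD, ih.mem_box h]
      · intro i a h
        rcases hupd h with ⟨rfl, rfl⟩ | ⟨-, h⟩
        · simp
        · exact List.mem_append_left _ (ih.mem_list h)
      · intro i a h
        rcases hupd h with ⟨rfl, rfl⟩ | ⟨-, h⟩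
        exacts [hbr, ih.le_row h]
      · intro i i' a h h'
        rcases hupd h with ⟨hi, ha⟩ | ⟨-, g⟩ <;> rcases hupd h' with ⟨hi', ha'⟩ | ⟨-, g'⟩
        · rw [hi, hi']
        · exact absurd (ha ▸ ih.mem_list g') hb
        · exact absurd (ha' ▸ ih.mem_list g) hb
        · exact ih.injective g g'
      · intro a ha hskip i hi hai
        have hab : a ≠ b := by rintro rfl; exact hskip r (by simp)
        have hal : a ∈ l := by simpa [hab] using ha
        refine hmono (ih.full_of_skipped hal (fun i' h => hskip i' ?_) i hi hai)
        have : i' ≠ r := by rintro rfl; simp [hr] at h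
        rwa [Function.update_of_ne this]
      · intro i a h i' hi' hai' hlt
        rcases hupd h with ⟨rfl, rfl⟩ | ⟨-, h⟩
        · exact hmono (htop i' hi' hai' hlt)
        · exact hmono (ih.full_above h i' hi' hai' hlt)

/-- The greedy procedure places as many letters as the minimal vertex cover allows. The cover
attaining equality is given by the rows `U` that are weakly above some empty box: a letter in `U`
cannot have been skipped, and the boxes outside `U` are filled with letters outside `U`. -/
theorem IsGreedyFilling.card_filled {n : ℕ} {D : Diagram n} {j : Fin n} {l : List (Fin n)}
    {f : Fin n → Option (Fin n)} (h : IsGreedyFilling D j l f) :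
    (Finset.univ.filter fun i => f i ≠ none).card = thetaCol D j l.toFinset := by
  set F := Finset.univ.filter fun i => f i ≠ none with hF
  have hval : ∀ i, ∃ a, i ∈ F → f i = some a := fun i => by
    by_cases hi : f i = none
    · exact ⟨i, by simp [hF, hi]⟩
    · obtain ⟨a, ha⟩ := Option.ne_none_iff_exists'.1 hi
      exact ⟨a, fun _ => ha⟩
  choose v hv using hval
  have hinj : Set.InjOn v F := fun i hi i' hi' hvv =>
    h.injective (hv i hi) (hvv ▸ hv i' hi')
  have hsplit : ∀ U : Finset (Fin n),
      F.card = (F.filter (v · ∈ U)).card + (F.filter (v · ∉ U)).card := fun U =>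
    (Finset.card_filter_add_card_filter_not _).symm
  apply le_antisymm
  · obtain ⟨U, hU, e⟩ := exists_cover_eq_thetaCol D j l.toFinset
    rw [e, hsplit U, cover]
    refine add_le_add ?_ (Finset.card_le_card fun i hi => ?_)
    · refine Finset.card_le_card_of_injOn v (fun i hi => ?_)
        (hinj.mono (Finset.coe_subset.2 (Finset.filter_subset _ _)))
      have hi := Finset.mem_filter.1 hi
      simpa using ⟨h.mem_list (hv i hi.1), hi.2⟩
    · have hi := Finset.mem_filter.1 hi
      rw [Finset.mem_sdiff, mem_column]
      exact ⟨h.mem_box (hv i hi.1), fun hiU => hi.2 (hU (h.le_row (hv i hi.1)) hiU)⟩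
  · set U : Finset (Fin n) := Finset.univ.filter fun a => ∃ i, (i, j) ∈ D ∧ f i = none ∧ a ≤ i
    have hmemU : ∀ a, a ∈ U ↔ ∃ i, (i, j) ∈ D ∧ f i = none ∧ a ≤ i := by simp [U]
    have hU : IsLowerSet (U : Set (Fin n)) := by
      intro a b hba ha
      obtain ⟨i, h1, h2, h3⟩ := (hmemU a).1 ha
      exact (hmemU b).2 ⟨i, h1, h2, hba.trans h3⟩
    refine (thetaCol_le_cover D j l.toFinset hU).trans ?_
    rw [hsplit U, cover]
    refine add_le_add ?_ (Finset.card_le_card fun i hi => ?_)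
    · refine (Finset.card_le_card fun a ha => ?_).trans (Finset.card_image_le (f := v))
      rw [Finset.mem_inter, List.mem_toFinset] at ha
      obtain ⟨i, hi⟩ : ∃ i, f i = some a := by
        by_contra! hskip
        obtain ⟨i, h1, h2, h3⟩ := (hmemU a).1 ha.2
        exact h.full_of_skipped ha.1 hskip i h1 h3 h2
      have hiF : i ∈ F := by simp [hF, hi]
      have hvi : v i = a := Option.some_injective _ ((hv i hiF).symm.trans hi)
      exact Finset.mem_image.2 ⟨i, Finset.mem_filter.2 ⟨hiF, hvi ▸ ha.2⟩, hvi⟩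
    · rw [Finset.mem_sdiff, mem_column, hmemU] at hi
      have hiF : i ∈ F := by
        simp only [hF, Finset.mem_filter, Finset.mem_univ, true_and]
        exact fun hn => hi.2 ⟨i, hi.1, hn, le_rfl⟩
      refine Finset.mem_filter.2 ⟨hiF, fun hvU => ?_⟩
      -- An empty box weakly below the row of `v i` lies below `i`, as `i ∉ U`, or above `i`,
      -- where the greedy choice has left no empty box.
      obtain ⟨i', h1, h2, h3⟩ := (hmemU _).1 hvU
      have hlt : i' < i := not_le.1 fun hle => hi.2 ⟨i', h1, h2, hle⟩
      exact h.full_above (hv i hiF) i' h1 h3 hlt h2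

/-! ### Summation over the columns -/

/-- The placements made after an initial segment `p` of `w` do not involve letters of `p`, so the
entries of `F_w(D)` in `p` are those present once exactly `p` has been placed. -/
theorem sum_appearances_eq_theta {n : ℕ} (D : Diagram n) (w : Equiv.Perm (Fin n))
    {p : List (Fin n)} (hp : p <+: List.ofFn w) :
    ∑ k ∈ p.toFinset, appearances D w k = theta D p.toFinset := by
  obtain ⟨q, hq⟩ := hp
  have hnd : (p ++ q).Nodup := hq ▸ List.nodup_ofFn.2 w.injective
  have hdis := List.nodup_append.1 hnd
  have hfill : ∀ i j, ∀ k ∈ p, filling D w i j = some k ↔ colFill D j p i = some k := by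
    intro i j k hk
    have e : filling D w i j = q.foldl (place D j) (colFill D j p) i := by
      rw [filling, ← hq, List.foldl_append, colFill]
    rw [e]
    refine ⟨fun h => (eq_some_or_mem_of_foldl_place q h).resolve_right fun hkq =>
      hdis.2.2 k hk k hkq rfl, foldl_place_eq_some q⟩
  have hcol : ∀ j, thetaCol D j p.toFinset =
      (Finset.univ.filter fun i => ∃ k ∈ p, colFill D j p i = some k).card := by
    intro j
    have hg := isGreedyFilling_colFill D j hdis.1
    rw [← hg.card_filled]
    congr 1
    ext i
    simp only [Finset.mem_filter, Finset.mem_univ, true_and, Option.ne_none_iff_exists']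
    exact ⟨fun ⟨k, hk⟩ => ⟨k, hg.mem_list hk, hk⟩, fun ⟨k, _, hk⟩ => ⟨k, hk⟩⟩
  have happ : ∀ k ∈ p.toFinset, appearances D w k =
      ∑ j, (Finset.univ.filter fun i => colFill D j p i = some k).card := by
    intro k hk
    rw [List.mem_toFinset] at hk
    rw [appearances, Finset.card_eq_sum_card_fiberwise (f := Prod.snd) (t := Finset.univ) (by simp)]
    refine Finset.sum_congr rfl fun j _ => ?_
    refine Finset.card_bij (fun b _ => b.1) ?_ ?_ ?_
    · rintro ⟨i, j'⟩ hb
      simp only [Finset.mem_filter] at hb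
      obtain ⟨⟨-, h⟩, rfl⟩ := hb
      simpa using (hfill _ _ k hk).1 h
    · rintro ⟨i, j'⟩ hb ⟨i', j''⟩ hb' rfl
      simp only [Finset.mem_filter] at hb hb'
      rw [hb.2, hb'.2]
    · intro i hi
      simp only [Finset.mem_filter, Finset.mem_univ, true_and] at hi
      refine ⟨(i, j), ?_, rfl⟩
      simp only [Finset.mem_filter, and_true]
      exact ⟨(isGreedyFilling_colFill D j hdis.1).mem_box hi, (hfill _ _ k hk).2 hi⟩
  rw [Finset.sum_congr rfl happ, Finset.sum_comm, theta]
  refine Finset.sum_congr rfl fun j _ => ?_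
  rw [hcol j, ← Finset.card_biUnion]
  · congr 1
    ext i; simp
  · intro k _ k' _ hkk
    refine Finset.disjoint_left.2 fun i h h' => hkk ?_
    simp only [Finset.mem_filter, Finset.mem_univ, true_and] at h h'
    exact Option.some_injective _ (h.symm.trans h')

theorem theta_submodular {n : ℕ} (D : Diagram n) (S T : Finset (Fin n)) :
    theta D (S ∩ T) + theta D (S ∪ T) ≤ theta D S + theta D T := by
  simp only [theta, ← Finset.sum_add_distrib]
  exact Finset.sum_le_sum fun j _ => thetaCol_submodular D j S T

theorem theta_univ {n : ℕ} (D : Diagram n) : theta D Finset.univ = D.card := by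
  rw [theta, Finset.card_eq_sum_card_fiberwise (f := Prod.snd) (t := Finset.univ) (by simp)]
  refine Finset.sum_congr rfl fun j _ => ?_
  rw [thetaCol_univ]
  refine Finset.card_bij (fun i _ => (i, j)) (by simp) (by simp) ?_
  rintro ⟨i, j'⟩ hb
  simp only [Finset.mem_filter] at hb
  obtain ⟨h, rfl⟩ := hb
  exact ⟨i, by simpa using h, rfl⟩

theorem schubitope_eq_basePolytope {n : ℕ} (D : Diagram n) :
    schubitope D = Submodular.basePolytope fun S => (theta D S : ℝ) := by
  ext x
  simp only [schubitope, Submodular.basePolytope, Set.mem_ofPred_eq, theta_univ]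
  refine and_congr_right fun hsum => ⟨fun h S => ?_, fun h S _ => h S⟩
  rcases eq_or_ne S Finset.univ with rfl | hS
  · rw [hsum, theta_univ]
  · exact h S (Finset.ssubset_univ_iff.2 hS)

theorem xVec_prefixTight {n : ℕ} (D : Diagram n) (w : Equiv.Perm (Fin n)) :
    Submodular.PrefixTight (fun S => (theta D S : ℝ)) (xVec D w) (List.ofFn w) := by
  intro p hp
  simp only [xVec]
  exact_mod_cast sum_appearances_eq_theta D w hp

theorem exists_perm_ofFn_eq {n : ℕ} {l : List (Fin n)} (hl : l.Nodup) (hmem : ∀ i, i ∈ l) :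
    ∃ w : Equiv.Perm (Fin n), List.ofFn w = l := by
  have hlen : l.length = n := by
    rw [← List.toFinset_card_of_nodup hl, show l.toFinset = Finset.univ by ext; simp [hmem]]
    simp
  have hinj : Function.Injective fun i : Fin n => l.get (i.cast hlen.symm) :=
    (List.nodup_iff_injective_get.1 hl).comp (Fin.cast_injective _)
  exact ⟨Equiv.ofBijective _ (Finite.injective_iff_bijective.1 hinj),
    List.ext_get (by simp [hlen]) (by simp)⟩

end Schubitope

theorem theorem1p1 (n : ℕ) (D : Schubitope.Diagram n) :
    Set.extremePoints ℝ (Schubitope.schubitope D) =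
      {x : Fin n → ℝ | ∃ w : Equiv.Perm (Fin n), x = Schubitope.xVec D w} := by
  have hsub : ∀ S T : Finset (Fin n), (Schubitope.theta D (S ∩ T) : ℝ) +
      Schubitope.theta D (S ∪ T) ≤ Schubitope.theta D S + Schubitope.theta D T :=
    fun S T => by exact_mod_cast Schubitope.theta_submodular D S T
  have h0 : (Schubitope.theta D ∅ : ℝ) = 0 := by
    simp [Schubitope.theta, Schubitope.thetaCol_empty]
  ext x
  rw [Schubitope.schubitope_eq_basePolytope,
    Submodular.mem_extremePoints_basePolytope_iff hsub h0, Set.mem_ofPred_eq]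
  constructor
  · rintro ⟨l, hl, hmem, ht⟩
    obtain ⟨w, rfl⟩ := Schubitope.exists_perm_ofFn_eq hl hmem
    exact ⟨w, funext fun a => ht.eq_of_mem hl (Schubitope.xVec_prefixTight D w) (hmem a)⟩
  · rintro ⟨w, rfl⟩
    exact ⟨List.ofFn w, List.nodup_ofFn.2 w.injective,
      fun i => (List.mem_ofFn' _ _).2 (w.surjective i), Schubitope.xVec_prefixTight D w⟩
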